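/- Let $r\ge 1$, let $\mathbf a=(a_1,\dots,a_r)$ be positive integers, and for $n\ge 0$ let $p_{\mathbf a}(n)$ be the number of tuples $(x_1,\dots,x_r)$ of non-negative integers with $a_1x_1+\cdots+a_rx_r=n$. Then $$\sum_{n=0}^\infty p_{\mathbf a}(n)z^n=\frac{1}{(1-z^{a_1})\cdots(1-z^{a_r})}\qquad(z\in\mathbb C,\ |z|<1),$$ and the rational function on the right has a partial fraction decomposition $$\frac{1}{(1-z^{a_1})\cdots(1-z^{a_r})}=\sum_{\lambda}\sum_{\ell=1}^{m(\lambda)}\frac{c_{\lambda,\ell}}{(\lambda-z)^{\ell}},$$ where $\lambda$ runs over the distinct complex roots of $(1-z^{a_1})\cdots(1-z^{a_r})$ and $m(\lambda)$ is the multiplicity of $\lambda$ as a root; in particular $m(1)=r$. In every such decomposition the coefficients at the pole $z=1$ are, for $1\le m\le r$, $$c_{1,m}=\frac{(m-1)!}{a_1\cdots a_r}\sum_{\ell=m}^{r}(-1)^{r-m}\,\frac{S(\ell,m)}{(\ell-1)!}\sum_{i_1+\cdots+i_r=r-\ell}\frac{B_{i_1}\cdots B_{i_r}}{i_1!\cdots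 i_r!}\,a_1^{i_1}\cdots a_r^{i_r},$$ where $S(\ell,m)$ are the Stirling numbers of the second kind, the inner sum is over tuples of non-negative integers, and the Bernoulli numbers $B_k$ are defined by $\dfrac{t}{e^t-1}=\sum_{k\ge 0}B_k\dfrac{t^k}{k!}$ (so $B_1=-\tfrac12$). -/

import Mathlib

open Polynomial

/-- The restricted partition function `p_a(n)`: the number of tuples `(x_1, …, x_r)` of
non-negative integers with `a_1 x_1 + ⋯ + a_r x_r = n`. (There are finitely many of them when
all `a_i` are positive.) -/
noncomputable def restrictedPartition {r : ℕ} (a : Fin r → ℕ) (n : ℕ) : ℕ :=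
  Nat.card {x : Fin r → ℕ // ∑ i, a i * x i = n}

/-- The denominator `(1 - z^{a_1}) ⋯ (1 - z^{a_r})` of the generating function of `p_a`. -/
noncomputable def partitionDenominator {r : ℕ} (a : Fin r → ℕ) : ℂ[X] :=
  ∏ i, (1 - X ^ a i)

/-- `c` is a system of coefficients of the partial fraction decomposition
`1 / ((1 - z^{a_1}) ⋯ (1 - z^{a_r})) = ∑_λ ∑_{ℓ = 1}^{m(λ)} c_{λ,ℓ} / (λ - z)^ℓ`,
where `λ` runs over the distinct complex roots of the denominator (that is, the `λ` with
`λ^{a_i} = 1` for some `i`) and `m(λ)` is the multiplicity of the root `λ`. Both sides are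
compared at every `z` which is not a root of the denominator. Only the values `c λ ℓ` with `λ` a
root and `1 ≤ ℓ ≤ m(λ)` matter. -/
def IsPartialFractionDecomposition {r : ℕ} (a : Fin r → ℕ) (c : ℂ → ℕ → ℂ) : Prop :=
  ∀ z : ℂ, (partitionDenominator a).eval z ≠ 0 →
    1 / (partitionDenominator a).eval z =
      ∑ μ ∈ (partitionDenominator a).roots.toFinset,
        ∑ ℓ ∈ Finset.Icc 1 ((partitionDenominator a).rootMultiplicity μ),
          c μ ℓ / (μ - z) ^ ℓ

/-!
For `|z| < 1` the product of the geometric series `∑ z^{a_i x_i}` is an absolutely convergent sum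
over `ℕ^r`, and grouping its terms by the value of `∑ a_i x_i` gives the generating function
(`hasSum_restrictedPartition`).

Clearing denominators turns a partial fraction decomposition into an identity of polynomials
(`isPartialFractionDecomposition_iff`), and such an identity exists because the powers
`(X - μ)^{m(μ)}` for distinct roots `μ` are coprime (`exists_sum_rootCofactor`).

The coefficients at `z = 1` are residues of `(1 - z)^{m - 1}` times the generating function,
computed in the coordinate `t` with `z = e^t`, entirely with formal power series. Put
`U(t) = (e^t - 1) / t`, whose inverse is the Bernoulli series `B(t)`. Substituting `e^t` into the
cleared identity and dividing by the denominator gives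
`∏ B(a_i t) = a_1 ⋯ a_r ∑_k (-1)^{r - k} c_{1,k} t^{r - k} B(t)^k + O(t^r)`
(`exists_prod_rescale_bernoulliPowerSeries_eq`). Multiply by `U(t)^{m - 1} e^t` and compare the
coefficients of `t^{r - m}`. On the right only `k = m` survives: the terms with `k < m` are divisible
by a higher power of `t`, and for `k > m` the coefficient is the residue of
`(e^t - 1)^{-(k - m + 1)} e^t`, which vanishes because this series is a derivative
(`coeff_bernoulliPowerSeries_pow_mul_exp`). On the left
`U(t)^{m - 1} e^t` is `t^{1 - m}` times the derivative of `(e^t - 1)^m / m`, whose coefficients are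
Stirling numbers (`coeff_expSubOneDivX_pow_mul_exp`).
-/

/-! ### The generating function -/

/-- A monomial sum over all of `ℕ^r` is a product of geometric series. -/
theorem summable_norm_and_hasSum_prod_pow {r : ℕ} (w : Fin r → ℂ) (hw : ∀ i, ‖w i‖ < 1) :
    Summable (fun x : Fin r → ℕ => ‖∏ i, w i ^ x i‖) ∧
      HasSum (fun x : Fin r → ℕ => ∏ i, w i ^ x i) (∏ i, (1 - w i)⁻¹) := by
  induction r with
  | zero => exact ⟨.of_finite, by simp⟩
  | succ r ih =>
    obtain ⟨hs, hh⟩ := ih (fun i => w i.succ) (fun i => hw i.succ)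
    have hs₀ : Summable fun k : ℕ => ‖w 0 ^ k‖ := by
      simpa only [norm_pow] using summable_geometric_of_lt_one (norm_nonneg _) (hw 0)
    have hh₀ := hasSum_geometric_of_norm_lt_one (hw 0)
    have hcons (x : ℕ × (Fin r → ℕ)) :
        ∏ i, w i ^ (Fin.consEquiv fun _ => ℕ) x i = w 0 ^ x.1 * ∏ i : Fin r, w i.succ ^ x.2 i := by
      simp [Fin.consEquiv, Fin.prod_univ_succ]
    have hnorm := hs₀.mul_norm hs
    have hprod : HasSum (fun x : ℕ × (Fin r → ℕ) => w 0 ^ x.1 * ∏ i : Fin r, w i.succ ^ x.2 i)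
        ((1 - w 0)⁻¹ * ∏ i : Fin r, (1 - w i.succ)⁻¹) :=
      HasSum.mul (f := fun k : ℕ => w 0 ^ k) (g := fun x : Fin r → ℕ => ∏ i : Fin r, w i.succ ^ x i)
        hh₀ hh (Summable.of_norm hnorm)
    constructor
    · refine (Fin.consEquiv fun _ : Fin (r + 1) => ℕ).summable_iff.1 ?_
      simpa only [Function.comp_def, hcons] using hnorm
    · rw [Fin.prod_univ_succ]
      refine (Fin.consEquiv fun _ : Fin (r + 1) => ℕ).hasSum_iff.1 ?_
      simpa only [Function.comp_def, hcons] using hprod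

theorem finite_restrictedPartition_solutions {r : ℕ} {a : Fin r → ℕ} (ha : ∀ i, 0 < a i)
    (n : ℕ) : Finite {x : Fin r → ℕ // ∑ i, a i * x i = n} := by
  refine ((Set.finite_Iic fun _ : Fin r => n).subset fun x hx i => ?_).to_subtype
  calc x i ≤ a i * x i := Nat.le_mul_of_pos_left _ (ha i)
    _ ≤ ∑ j, a j * x j :=
      Finset.single_le_sum (f := fun j => a j * x j) (fun _ _ => Nat.zero_le _) (Finset.mem_univ i)
    _ = n := hx

theorem hasSum_restrictedPartition {r : ℕ} {a : Fin r → ℕ} (ha : ∀ i, 0 < a i) {z : ℂ}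
    (hz : ‖z‖ < 1) :
    HasSum (fun n : ℕ => (restrictedPartition a n : ℂ) * z ^ n)
      (1 / (partitionDenominator a).eval z) := by
  have hw (i : Fin r) : ‖z ^ a i‖ < 1 := by
    rw [norm_pow]
    exact pow_lt_one₀ (norm_nonneg _) hz (ha i).ne'
  have hh := (summable_norm_and_hasSum_prod_pow _ hw).2
  rw [← (Equiv.sigmaFiberEquiv fun x : Fin r → ℕ => ∑ i, a i * x i).hasSum_iff] at hh
  have hval : 1 / (partitionDenominator a).eval z = ∏ i, (1 - z ^ a i)⁻¹ := by
    simp [partitionDenominator, eval_prod]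
  rw [hval]
  refine hh.sigma fun n => ?_
  have := finite_restrictedPartition_solutions ha n
  have := Fintype.ofFinite {x : Fin r → ℕ // ∑ i, a i * x i = n}
  convert! hasSum_fintype (fun _ : {x : Fin r → ℕ // ∑ i, a i * x i = n} => z ^ n) using 1
  · ext ⟨x, hx⟩
    subst hx
    simp [Equiv.sigmaFiberEquiv, ← pow_mul, Finset.prod_pow_eq_pow_sum]
  · simp [restrictedPartition, Nat.card_eq_fintype_card]

/-! ### Partial fractions -/

/-- The cofactor `f / (X - μ)^{m(μ)}` of a root `μ` of multiplicity `m(μ)`. -/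
noncomputable def rootCofactor (f : ℂ[X]) (μ : ℂ) : ℂ[X] :=
  f /ₘ (X - C μ) ^ f.rootMultiplicity μ

theorem pow_mul_rootCofactor (f : ℂ[X]) (μ : ℂ) :
    (X - C μ) ^ f.rootMultiplicity μ * rootCofactor f μ = f :=
  f.pow_mul_divByMonic_rootMultiplicity_eq μ

/-- A partial fraction `1 / (μ - z)^ℓ` becomes a polynomial after multiplication by `f`. -/
theorem eval_div_sub_pow {f : ℂ[X]} {z μ : ℂ} (hz : f.eval z ≠ 0) {ℓ : ℕ}
    (hℓ : ℓ ∈ Finset.Icc 1 (f.rootMultiplicity μ)) (c : ℂ) :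
    f.eval z * (c / (μ - z) ^ ℓ) =
      (C ((-1) ^ ℓ * c) * (X - C μ) ^ (f.rootMultiplicity μ - ℓ) * rootCofactor f μ).eval z := by
  obtain ⟨hℓ₁, hℓ₂⟩ := Finset.mem_Icc.1 hℓ
  have hf := congrArg (eval z) (pow_mul_rootCofactor f μ)
  have hsub : z - μ ≠ 0 := by
    rintro h
    apply hz
    rw [← hf, eval_mul, eval_pow, eval_sub, eval_X, eval_C, h, zero_pow (by omega), zero_mul]
  have hpow : (z - μ) ^ f.rootMultiplicity μ =
      (z - μ) ^ (f.rootMultiplicity μ - ℓ) * (z - μ) ^ ℓ := by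
    rw [← pow_add, Nat.sub_add_cancel hℓ₂]
  have hneg : (μ - z) ^ ℓ = (-1) ^ ℓ * (z - μ) ^ ℓ := by
    rw [← mul_pow]
    ring
  have hone : ((-1 : ℂ) ^ ℓ) * (-1) ^ ℓ = 1 := by
    rw [← mul_pow]
    simp
  simp only [eval_mul, eval_pow, eval_sub, eval_X, eval_C] at hf ⊢
  rw [← mul_div_assoc, div_eq_iff (pow_ne_zero _ (by simpa [sub_eq_zero, eq_comm] using hsub)),
    hneg, ← hf, hpow]
  linear_combination (-((z - μ) ^ (f.rootMultiplicity μ - ℓ) * (z - μ) ^ ℓ *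
    (rootCofactor f μ).eval z * c)) * hone

theorem partitionDenominator_ne_zero {r : ℕ} {a : Fin r → ℕ} (ha : ∀ i, 0 < a i) :
    partitionDenominator a ≠ 0 := by
  refine Finset.prod_ne_zero_iff.2 fun i _ h => ?_
  have := congrArg (eval 0) h
  simp [(ha i).ne'] at this

/-- Clearing denominators turns a partial fraction decomposition into an identity of
polynomials. -/
theorem isPartialFractionDecomposition_iff {r : ℕ} {a : Fin r → ℕ} (ha : ∀ i, 0 < a i)
    (c : ℂ → ℕ → ℂ) :
    IsPartialFractionDecomposition a c ↔
      1 = ∑ μ ∈ (partitionDenominator a).roots.toFinset,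
        ∑ ℓ ∈ Finset.Icc 1 ((partitionDenominator a).rootMultiplicity μ),
          C ((-1) ^ ℓ * c μ ℓ) *
            (X - C μ) ^ ((partitionDenominator a).rootMultiplicity μ - ℓ) *
              rootCofactor (partitionDenominator a) μ := by
  have hD := partitionDenominator_ne_zero ha
  unfold IsPartialFractionDecomposition
  set D := partitionDenominator a
  have key (z : ℂ) (hz : D.eval z ≠ 0) :
      (1 / D.eval z = ∑ μ ∈ D.roots.toFinset, ∑ ℓ ∈ Finset.Icc 1 (D.rootMultiplicity μ),
          c μ ℓ / (μ - z) ^ ℓ) ↔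
        eval z 1 = (∑ μ ∈ D.roots.toFinset, ∑ ℓ ∈ Finset.Icc 1 (D.rootMultiplicity μ),
          C ((-1) ^ ℓ * c μ ℓ) * (X - C μ) ^ (D.rootMultiplicity μ - ℓ) *
            rootCofactor D μ).eval z := by
    rw [div_eq_iff hz, eval_one, mul_comm, Finset.mul_sum, eval_finsetSum]
    refine Eq.congr rfl (Finset.sum_congr rfl fun μ _ => ?_)
    rw [Finset.mul_sum, eval_finsetSum]
    exact Finset.sum_congr rfl fun ℓ hℓ => eval_div_sub_pow hz hℓ _
  constructor
  · intro h
    refine eq_of_infinite_eval_eq _ _ (Set.Infinite.mono (s := {z | D.eval z ≠ 0})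
      (fun z hz => (key z hz).1 (h z hz)) ?_)
    refine Set.Finite.infinite_compl (s := {z | D.eval z = 0}) ?_
    exact finite_setOfPred_isRoot hD
  · intro h z hz
    exact (key z hz).2 (congrArg (eval z) h)

/-- Existence of the partial fraction decomposition of `1 / f`, with denominators cleared. -/
theorem exists_sum_rootCofactor {f : ℂ[X]} (hf : f.natDegree ≠ 0) :
    ∃ c : ℂ → ℕ → ℂ, 1 = ∑ μ ∈ f.roots.toFinset, ∑ ℓ ∈ Finset.Icc 1 (f.rootMultiplicity μ),
      C ((-1) ^ ℓ * c μ ℓ) * (X - C μ) ^ (f.rootMultiplicity μ - ℓ) * rootCofactor f μ := by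
  classical
  have hf₀ : f ≠ 0 := by
    rintro rfl
    simp at hf
  have hfac : f = C f.leadingCoeff * ∏ μ ∈ f.roots.toFinset, (X - C μ) ^ f.rootMultiplicity μ := by
    conv_lhs => rw [(IsAlgClosed.splits f).eq_prod_roots]
    rw [Finset.prod_multiset_map_count]
    simp [count_roots]
  have hlead : f.leadingCoeff ≠ 0 := leadingCoeff_ne_zero.2 hf₀
  have hcof (μ : ℂ) (hμ : μ ∈ f.roots.toFinset) : rootCofactor f μ = C f.leadingCoeff *
      ∏ ν ∈ f.roots.toFinset.erase μ, (X - C ν) ^ f.rootMultiplicity ν := by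
    refine mul_left_cancel₀ (pow_ne_zero (f.rootMultiplicity μ) (X_sub_C_ne_zero μ)) ?_
    rw [pow_mul_rootCofactor, mul_left_comm,
      Finset.mul_prod_erase _ (fun ν => (X - C ν) ^ f.rootMultiplicity ν) hμ]
    exact hfac
  obtain ⟨q, s, hs, hsum⟩ := eq_quo_mul_prod_pow_add_sum_rem_mul_prod_pow (1 : ℂ[X])
    (s := f.roots.toFinset) (g := fun μ => X - C μ) (fun μ _ => monic_X_sub_C μ)
    (fun μ _ ν _ h => isCoprime_X_sub_C_of_isUnit_sub (sub_ne_zero.2 h).isUnit)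
    (fun μ => f.rootMultiplicity μ)
  have hsC (μ : ℂ) (hμ : μ ∈ f.roots.toFinset) (j : Fin (f.rootMultiplicity μ)) :
      s μ j = C ((s μ j).coeff 0) := by
    refine eq_C_of_degree_le_zero ?_
    have h := hs μ hμ j
    rw [degree_X_sub_C] at h
    exact Nat.WithBot.lt_one_iff_le_zero.1 h
  set P : ℂ[X] := ∏ μ ∈ f.roots.toFinset, (X - C μ) ^ f.rootMultiplicity μ with hP
  have hPmonic : P.Monic := monic_prod_of_monic _ _ fun μ _ => (monic_X_sub_C μ).pow _
  have hPdeg : (0 : WithBot ℕ) < P.degree := by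
    rw [← natDegree_pos_iff_degree_pos]
    rw [hfac, natDegree_C_mul hlead] at hf
    exact Nat.pos_of_ne_zero hf
  have hterm (μ : ℂ) (hμ : μ ∈ f.roots.toFinset) (j : Fin (f.rootMultiplicity μ)) :
      (s μ j * (X - C μ) ^ j.1 *
        ∏ ν ∈ f.roots.toFinset.erase μ, (X - C ν) ^ f.rootMultiplicity ν).degree < P.degree := by
    have hM : (∏ ν ∈ f.roots.toFinset.erase μ, (X - C ν) ^ f.rootMultiplicity ν).Monic :=
      monic_prod_of_monic _ _ fun ν _ => (monic_X_sub_C ν).pow _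
    rw [hP, ← Finset.mul_prod_erase _ (fun ν => (X - C ν) ^ f.rootMultiplicity ν) hμ, hsC μ hμ j,
      degree_mul, degree_mul, degree_mul, degree_pow, degree_pow, degree_X_sub_C, nsmul_one,
      nsmul_one]
    refine WithBot.add_lt_add_right (degree_ne_bot.2 hM.ne_zero) ?_
    calc (C ((s μ j).coeff 0)).degree + (j.1 : WithBot ℕ)
        ≤ 0 + (j.1 : WithBot ℕ) := by gcongr; exact degree_C_le
      _ < _ := by
        rw [zero_add]
        exact_mod_cast j.2
  -- `q * P` is the difference of terms of degree less than that of `P`.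
  have hq : q = 0 := by
    by_contra hq
    have hle : P.degree ≤ (q * P).degree := by
      rw [mul_comm]
      exact degree_le_mul_left _ hq
    refine hle.not_gt ?_
    rw [eq_sub_of_add_eq hsum.symm]
    refine (degree_sub_le _ _).trans_lt (max_lt (degree_one_le.trans_lt hPdeg) ?_)
    have hbot : ⊥ < P.degree := bot_lt_iff_ne_bot.2 (degree_ne_bot.2 hPmonic.ne_zero)
    refine (degree_sum_le _ _).trans_lt ((Finset.sup_lt_iff hbot).2 fun μ hμ => ?_)
    exact (degree_sum_le _ _).trans_lt ((Finset.sup_lt_iff hbot).2 fun j _ => hterm μ hμ j)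
  rw [hq, zero_mul, zero_add] at hsum
  refine ⟨fun μ ℓ => (-1) ^ ℓ * (f.leadingCoeff⁻¹ *
    if h : f.rootMultiplicity μ - ℓ < f.rootMultiplicity μ then (s μ ⟨_, h⟩).coeff 0 else 0), ?_⟩
  conv_lhs => rw [hsum]
  refine Finset.sum_congr rfl fun μ hμ => ?_
  refine Finset.sum_bij (fun j _ => f.rootMultiplicity μ - j.1) (fun j _ => ?_)
    (fun j _ j' _ h => ?_) (fun ℓ hℓ => ?_) (fun j _ => ?_)
  · have := j.2
    exact Finset.mem_Icc.2 (by omega)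
  · have := j.2
    have := j'.2
    ext
    omega
  · obtain ⟨h₁, h₂⟩ := Finset.mem_Icc.1 hℓ
    exact ⟨⟨f.rootMultiplicity μ - ℓ, by omega⟩, Finset.mem_univ _, by simp; omega⟩
  · have hj : f.rootMultiplicity μ - (f.rootMultiplicity μ - j.1) = j.1 := by
      have := j.2
      omega
    have hneg (k : ℕ) (x : ℂ) : (-1) ^ k * ((-1) ^ k * x) = x := by
      rw [← mul_assoc, ← mul_pow]
      simp
    rw [hcof μ hμ, hneg]
    simp only [hj, j.2, dite_true]
    have hinv : C (f.leadingCoeff⁻¹) * C f.leadingCoeff = 1 := by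
      rw [← C_mul, inv_mul_cancel₀ hlead, C_1]
    conv_lhs => rw [hsC μ hμ j]
    rw [C_mul]
    linear_combination (-(C ((s μ j).coeff 0) * (X - C μ) ^ j.1 *
      ∏ ν ∈ f.roots.toFinset.erase μ, (X - C ν) ^ f.rootMultiplicity ν)) * hinv

/-! ### The pole at `1` -/

/-- The cofactor of `(1 - z)^r` in the denominator. -/
noncomputable def geomCofactor {r : ℕ} (a : Fin r → ℕ) : ℂ[X] :=
  ∏ i, ∑ j ∈ Finset.range (a i), X ^ j

theorem partitionDenominator_eq {r : ℕ} (a : Fin r → ℕ) :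
    partitionDenominator a = (1 - X) ^ r * geomCofactor a := by
  have h : ((1 : ℂ[X]) - X) ^ r = ∏ _i : Fin r, (1 - X) := by simp
  rw [h, geomCofactor, ← Finset.prod_mul_distrib]
  exact Finset.prod_congr rfl fun i _ => (mul_neg_geom_sum X (a i)).symm

theorem rootMultiplicity_one_partitionDenominator {r : ℕ} {a : Fin r → ℕ} (ha : ∀ i, 0 < a i) :
    (partitionDenominator a).rootMultiplicity 1 = r := by
  have hG : (geomCofactor a).eval 1 ≠ 0 := by
    simp [geomCofactor, eval_prod, eval_finsetSum, Finset.prod_ne_zero_iff, (ha _).ne']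
  have hG' : (-1) ^ r * geomCofactor a ≠ 0 := by
    intro h
    have := congrArg (eval 1) h
    simp [hG] at this
  have h : partitionDenominator a = (-1) ^ r * geomCofactor a * (X - C 1) ^ r := by
    rw [partitionDenominator_eq, C_1, mul_right_comm, ← mul_pow]
    ring
  rw [h, rootMultiplicity_mul_X_sub_C_pow hG', rootMultiplicity_eq_zero (by simp [hG]), zero_add]

/-- All terms of the cleared partial fraction identity at poles other than `1` are divisible by
`(1 - X)^r`. -/
theorem exists_local_identity_at_one {r : ℕ} (hr : 1 ≤ r) {a : Fin r → ℕ} (ha : ∀ i, 0 < a i)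
    {c : ℂ → ℕ → ℂ} (hc : IsPartialFractionDecomposition a c) :
    ∃ P : ℂ[X], 1 = geomCofactor a * ∑ k ∈ Finset.Icc 1 r, C (c 1 k) * (1 - X) ^ (r - k) +
      (1 - X) ^ r * P := by
  have hmult := rootMultiplicity_one_partitionDenominator ha
  rw [isPartialFractionDecomposition_iff ha] at hc
  have hmem : (1 : ℂ) ∈ (partitionDenominator a).roots.toFinset := by
    rw [Multiset.mem_toFinset, ← Multiset.one_le_count_iff_mem, count_roots, hmult]
    exact hr
  have hcof : rootCofactor (partitionDenominator a) 1 = (-1) ^ r * geomCofactor a := by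
    refine mul_left_cancel₀ (pow_ne_zero r (X_sub_C_ne_zero (1 : ℂ))) ?_
    have h := pow_mul_rootCofactor (partitionDenominator a) 1
    rw [hmult] at h
    rw [h, partitionDenominator_eq, C_1, ← mul_assoc, ← mul_pow]
    ring
  have hdvd : (1 - X) ^ r ∣ ∑ μ ∈ (partitionDenominator a).roots.toFinset.erase 1,
        ∑ ℓ ∈ Finset.Icc 1 ((partitionDenominator a).rootMultiplicity μ),
          C ((-1) ^ ℓ * c μ ℓ) *
            (X - C μ) ^ ((partitionDenominator a).rootMultiplicity μ - ℓ) *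
              rootCofactor (partitionDenominator a) μ := by
    refine Finset.dvd_sum fun μ hμ => Finset.dvd_sum fun ℓ _ => Dvd.dvd.mul_left ?_ _
    have hcop : IsCoprime ((1 - X : ℂ[X]) ^ r)
        ((X - C μ) ^ (partitionDenominator a).rootMultiplicity μ) := by
      have h := isCoprime_X_sub_C_of_isUnit_sub
        (sub_ne_zero.2 (Finset.ne_of_mem_erase hμ).symm).isUnit
      refine IsCoprime.pow ?_
      simpa using h.neg_left
    refine hcop.dvd_of_dvd_mul_left ?_
    rw [pow_mul_rootCofactor, partitionDenominator_eq]
    exact dvd_mul_right _ _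
  obtain ⟨P, hP⟩ := hdvd
  refine ⟨P, hc.trans ?_⟩
  rw [← Finset.add_sum_erase _ _ hmem, hP, hmult, hcof, Finset.mul_sum]
  refine congrArg (· + _) ?_
  refine Finset.sum_congr rfl fun k hk => ?_
  obtain ⟨-, hk⟩ := Finset.mem_Icc.1 hk
  have hsign : ((-1 : ℂ[X])) ^ k * (X - 1) ^ (r - k) * (-1) ^ r = (1 - X) ^ (r - k) := by
    obtain ⟨j, rfl⟩ := Nat.exists_eq_add_of_le hk
    have h₁ : ((-1 : ℂ[X]) ^ k) * (-1) ^ k = 1 := by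
      rw [← mul_pow]
      simp
    rw [Nat.add_sub_cancel_left, show (1 - X : ℂ[X]) = -1 * (X - 1) by ring, mul_pow, pow_add]
    linear_combination (X - 1) ^ j * (-1) ^ j * h₁
  rw [← hsign]
  simp only [C_mul, C_pow, C_neg, C_1]
  ring

/-! ### Power series -/

/-- The power series `(e^t - 1) / t`. -/
noncomputable def expSubOneDivX : PowerSeries ℂ :=
  PowerSeries.mk fun n => ((n + 1).factorial : ℂ)⁻¹

theorem X_mul_expSubOneDivX : PowerSeries.X * expSubOneDivX = PowerSeries.exp ℂ - 1 := by
  ext n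
  cases n with
  | zero => simp
  | succ n => simp [PowerSeries.coeff_succ_X_mul, expSubOneDivX, PowerSeries.coeff_exp,
      PowerSeries.coeff_one]

/-- The Bernoulli series `t / (e^t - 1)` is the inverse of `(e^t - 1) / t`. -/
theorem bernoulliPowerSeries_mul_expSubOneDivX :
    bernoulliPowerSeries ℂ * expSubOneDivX = 1 := by
  have h := bernoulliPowerSeries_mul_exp_sub_one ℂ
  rw [← X_mul_expSubOneDivX, mul_left_comm] at h
  exact mul_left_cancel₀ PowerSeries.X_ne_zero (h.trans (mul_one _).symm)

/-- As `B(t) = t / (e^t - 1)`, this coefficient of `B(t)^{k + 1} e^t` is the residue of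
`(e^t - 1)^{-(k + 1)} e^t`, which is the derivative of `-(e^t - 1)^{-k} / k` when
`0 < k`, and so has no `t^{-1}` term. -/
theorem coeff_bernoulliPowerSeries_pow_mul_exp (k : ℕ) :
    PowerSeries.coeff k (bernoulliPowerSeries ℂ ^ (k + 1) * PowerSeries.exp ℂ) =
      if k = 0 then 1 else 0 := by
  have hBU := bernoulliPowerSeries_mul_expSubOneDivX
  have hU := X_mul_expSubOneDivX
  generalize hB : bernoulliPowerSeries ℂ = B at *
  generalize expSubOneDivX = U at *
  have hexp : PowerSeries.exp ℂ = U + PowerSeries.X * PowerSeries.derivative ℂ U := by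
    have h := congrArg (PowerSeries.derivative ℂ) hU
    simp only [Derivation.leibniz, map_sub, PowerSeries.derivative_exp, smul_eq_mul,
      PowerSeries.derivative_X, PowerSeries.derivative_one] at h
    linear_combination -h
  obtain rfl | hk := Nat.eq_zero_or_pos k
  · have hB₀ : PowerSeries.constantCoeff B = 1 := by
      simp [← hB, bernoulliPowerSeries]
    simp [hB₀]
  rw [if_neg hk.ne']
  have hdB : PowerSeries.derivative ℂ B = -B ^ 2 * PowerSeries.derivative ℂ U := by
    have h := congrArg (PowerSeries.derivative ℂ) hBU
    simp only [Derivation.leibniz, smul_eq_mul, PowerSeries.derivative_one] at h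
    linear_combination B * h - PowerSeries.derivative ℂ B * hBU
  obtain ⟨j, rfl⟩ : ∃ j, k = j + 1 := ⟨k - 1, by omega⟩
  -- In `k B^k - t (B^k)'` the coefficient of `t^k` cancels.
  have key : ((j + 1 : ℕ) : PowerSeries ℂ) * (B ^ (j + 1 + 1) * PowerSeries.exp ℂ) =
      ((j + 1 : ℕ) : PowerSeries ℂ) * B ^ (j + 1) -
        PowerSeries.X * PowerSeries.derivative ℂ (B ^ (j + 1)) := by
    rw [PowerSeries.derivative_pow, hexp, hdB, Nat.add_sub_cancel]
    linear_combination ((j + 1 : ℕ) : PowerSeries ℂ) * B ^ (j + 1) * hBU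
  have h := congrArg (PowerSeries.coeff (j + 1)) key
  rw [map_sub, PowerSeries.coeff_succ_X_mul, PowerSeries.coeff_derivative, ← map_natCast
    (PowerSeries.C : ℂ →+* PowerSeries ℂ), PowerSeries.coeff_C_mul, PowerSeries.coeff_C_mul] at h
  have hj : ((j + 1 : ℕ) : ℂ) ≠ 0 := Nat.cast_ne_zero.2 j.succ_ne_zero
  refine (mul_eq_zero.1 (h.trans ?_)).resolve_left hj
  push_cast
  ring

/-- The exponential generating function of the Stirling numbers of the second kind,
`(e^t - 1)^m = m! ∑ S(n, m) t^n / n!`. -/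
theorem coeff_exp_sub_one_pow (m n : ℕ) :
    PowerSeries.coeff n ((PowerSeries.exp ℂ - 1) ^ m) =
      m.factorial * (Nat.stirlingSecond n m : ℂ) / n.factorial := by
  induction n generalizing m with
  | zero =>
    cases m with
    | zero => simp
    | succ m => simp [zero_pow]
  | succ n ih =>
    cases m with
    | zero => simp [PowerSeries.coeff_one]
    | succ m =>
      -- `d/dt (e^t - 1)^{m+1} = (m + 1) ((e^t - 1)^{m+1} + (e^t - 1)^m)` is the recursion for `S`.
      have hd : PowerSeries.derivative ℂ ((PowerSeries.exp ℂ - 1) ^ (m + 1)) =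
          ((m + 1 : ℕ) : PowerSeries ℂ) *
            ((PowerSeries.exp ℂ - 1) ^ (m + 1) + (PowerSeries.exp ℂ - 1) ^ m) := by
        rw [PowerSeries.derivative_pow, Nat.add_sub_cancel, map_sub, PowerSeries.derivative_exp,
          PowerSeries.derivative_one]
        ring
      have h := congrArg (PowerSeries.coeff n) hd
      rw [PowerSeries.coeff_derivative, ← map_natCast (PowerSeries.C : ℂ →+* PowerSeries ℂ),
        PowerSeries.coeff_C_mul, map_add, ih, ih] at h
      have hn : (n : ℂ) + 1 ≠ 0 := Nat.cast_add_one_ne_zero n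
      have hf : (n.factorial : ℂ) ≠ 0 := Nat.cast_ne_zero.2 n.factorial_ne_zero
      rw [eq_div_iff (Nat.cast_ne_zero.2 (n + 1).factorial_ne_zero), Nat.stirlingSecond_succ_succ]
      simp only [Nat.factorial_succ] at h ⊢
      push_cast at h ⊢
      field_simp at h
      linear_combination h

/-- With `U(t) = (e^t - 1) / t`, the series `t^k U(t)^k e^t` is the derivative of
`(e^t - 1)^{k + 1} / (k + 1)`. -/
theorem coeff_expSubOneDivX_pow_mul_exp (k j : ℕ) :
    PowerSeries.coeff j (expSubOneDivX ^ k * PowerSeries.exp ℂ) =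
      k.factorial * (Nat.stirlingSecond (j + k + 1) (k + 1) : ℂ) / (j + k).factorial := by
  have hd : PowerSeries.derivative ℂ ((PowerSeries.exp ℂ - 1) ^ (k + 1)) =
      ((k + 1 : ℕ) : PowerSeries ℂ) *
        (PowerSeries.X ^ k * (expSubOneDivX ^ k * PowerSeries.exp ℂ)) := by
    rw [PowerSeries.derivative_pow, Nat.add_sub_cancel, map_sub, PowerSeries.derivative_exp,
      PowerSeries.derivative_one, ← X_mul_expSubOneDivX]
    ring
  have h := congrArg (PowerSeries.coeff (j + k)) hd
  rw [PowerSeries.coeff_derivative, ← map_natCast (PowerSeries.C : ℂ →+* PowerSeries ℂ),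
    PowerSeries.coeff_C_mul, PowerSeries.coeff_X_pow_mul, coeff_exp_sub_one_pow] at h
  have hf : ((j + k).factorial : ℂ) ≠ 0 := Nat.cast_ne_zero.2 (Nat.factorial_ne_zero _)
  have hk : (k : ℂ) + 1 ≠ 0 := Nat.cast_add_one_ne_zero k
  have hj : (j : ℂ) + k + 1 ≠ 0 := by
    simpa using Nat.cast_add_one_ne_zero (R := ℂ) (j + k)
  rw [eq_div_iff hf]
  simp only [Nat.factorial_succ] at h
  push_cast at h
  field_simp at h
  linear_combination -h

theorem coeff_prod_rescale_bernoulliPowerSeries {r : ℕ} (a : Fin r → ℕ) (n : ℕ) :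
    PowerSeries.coeff n (∏ k, PowerSeries.rescale (a k : ℂ) (bernoulliPowerSeries ℂ)) =
      ∑ i ∈ Finset.piAntidiag (Finset.univ : Finset (Fin r)) n,
        (∏ k, ((_root_.bernoulli (i k) : ℚ) : ℂ)) / (∏ k, ((i k).factorial : ℂ)) *
          ∏ k, (a k : ℂ) ^ i k := by
  rw [PowerSeries.coeff_prod]
  refine Finset.sum_bij (fun l _ => ⇑l) (fun l hl => ?_) (fun l _ l' _ h => DFunLike.coe_injective h)
    (fun i hi => ⟨Finsupp.equivFunOnFinite.symm i, ?_, rfl⟩) (fun l _ => ?_)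
  · simpa [Finset.mem_finsuppAntidiag] using hl
  · simpa [Finset.mem_finsuppAntidiag] using hi
  · simp [PowerSeries.coeff_rescale, bernoulliPowerSeries, Finset.prod_mul_distrib,
      Finset.prod_div_distrib, mul_comm]

/-! ### The coefficients at the pole `1` -/

theorem aeval_exp_one_sub_X :
    aeval (PowerSeries.exp ℂ) (1 - X : ℂ[X]) = -(PowerSeries.X * expSubOneDivX) := by
  rw [X_mul_expSubOneDivX]
  simp

theorem aeval_exp_partitionDenominator {r : ℕ} (a : Fin r → ℕ) :
    aeval (PowerSeries.exp ℂ) (partitionDenominator a) =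
      (-PowerSeries.X) ^ r * (PowerSeries.C (∏ i, (a i : ℂ)) *
        ∏ i, PowerSeries.rescale (a i : ℂ) expSubOneDivX) := by
  have h : (-PowerSeries.X : PowerSeries ℂ) ^ r = ∏ _i : Fin r, (-PowerSeries.X) := by simp
  rw [h, map_prod, partitionDenominator, map_prod, ← Finset.prod_mul_distrib,
    ← Finset.prod_mul_distrib]
  refine Finset.prod_congr rfl fun i _ => ?_
  have hi := congrArg (PowerSeries.rescale (a i : ℂ)) X_mul_expSubOneDivX
  rw [map_mul, PowerSeries.rescale_X, map_sub, map_one] at hi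
  rw [map_sub, map_one, map_pow, aeval_X, PowerSeries.exp_pow_eq_rescale_exp]
  linear_combination hi

/-- The partial fraction decomposition at `z = e^t`: up to terms regular at `t = 0`, the product
of the Bernoulli series is a combination of the powers of `B(t) = t / (e^t - 1)`. -/
theorem exists_prod_rescale_bernoulliPowerSeries_eq {r : ℕ} (hr : 1 ≤ r) {a : Fin r → ℕ}
    (ha : ∀ i, 0 < a i) {c : ℂ → ℕ → ℂ} (hc : IsPartialFractionDecomposition a c) :
    ∃ R : PowerSeries ℂ, ∏ i, PowerSeries.rescale (a i : ℂ) (bernoulliPowerSeries ℂ) =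
      PowerSeries.C (∏ i, (a i : ℂ)) * ∑ k ∈ Finset.Icc 1 r,
        PowerSeries.C ((-1) ^ (r - k) * c 1 k) *
          (PowerSeries.X ^ (r - k) * bernoulliPowerSeries ℂ ^ k) + PowerSeries.X ^ r * R := by
  obtain ⟨P, hP⟩ := exists_local_identity_at_one hr ha hc
  have hD := aeval_exp_partitionDenominator a
  rw [partitionDenominator_eq, map_mul, map_pow, aeval_exp_one_sub_X] at hD
  have hBU := bernoulliPowerSeries_mul_expSubOneDivX
  have hTV : (∏ i, PowerSeries.rescale (a i : ℂ) (bernoulliPowerSeries ℂ)) *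
      ∏ i, PowerSeries.rescale (a i : ℂ) expSubOneDivX = 1 := by
    rw [← Finset.prod_mul_distrib]
    refine Finset.prod_eq_one fun i _ => ?_
    rw [← map_mul, hBU, map_one]
  replace hP := congrArg (aeval (PowerSeries.exp ℂ)) hP
  rw [map_one, map_add, map_mul, map_mul, map_pow, map_sum, aeval_exp_one_sub_X] at hP
  generalize aeval (PowerSeries.exp ℂ) P = p at hP
  generalize aeval (PowerSeries.exp ℂ) (geomCofactor a) = q at hP hD
  generalize (∏ i, PowerSeries.rescale (a i : ℂ) expSubOneDivX) = V at hD hTV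
  generalize (∏ i, PowerSeries.rescale (a i : ℂ) (bernoulliPowerSeries ℂ)) = T at hTV ⊢
  have hS : ∀ k ∈ Finset.Icc 1 r, bernoulliPowerSeries ℂ ^ r *
      aeval (PowerSeries.exp ℂ) (C (c 1 k) * (1 - X) ^ (r - k)) =
        PowerSeries.C ((-1) ^ (r - k) * c 1 k) *
          (PowerSeries.X ^ (r - k) * bernoulliPowerSeries ℂ ^ k) := by
    intro k hk
    obtain ⟨-, hk⟩ := Finset.mem_Icc.1 hk
    have hB : bernoulliPowerSeries ℂ ^ r * expSubOneDivX ^ (r - k) =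
        bernoulliPowerSeries ℂ ^ k := by
      conv_lhs => rw [← Nat.add_sub_cancel' hk, pow_add, Nat.add_sub_cancel_left]
      rw [mul_assoc, ← mul_pow, hBU, one_pow, mul_one]
    rw [map_mul, aeval_C, map_pow, aeval_exp_one_sub_X, ← hB, neg_pow, mul_pow]
    simp only [map_mul, map_pow, map_neg, map_one]
    rw [show algebraMap ℂ (PowerSeries ℂ) (c 1 k) = PowerSeries.C (c 1 k) from rfl]
    ring
  rw [← Finset.sum_congr rfl hS, ← Finset.mul_sum]
  generalize (∑ k ∈ Finset.Icc 1 r,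
    aeval (PowerSeries.exp ℂ) (C (c 1 k) * (1 - X) ^ (r - k))) = S at hP
  generalize expSubOneDivX = U at *
  generalize bernoulliPowerSeries ℂ = B at *
  have hq : U ^ r * q = PowerSeries.C (∏ i, (a i : ℂ)) * V := by
    refine mul_left_cancel₀ (pow_ne_zero r (neg_ne_zero.2 PowerSeries.X_ne_zero)) ?_
    rw [← hD, ← mul_assoc, ← mul_pow, neg_mul]
  have hBUr : B ^ r * U ^ r = 1 := by
    rw [← mul_pow, hBU, one_pow]
  have hX : (-(PowerSeries.X * U)) ^ r = PowerSeries.X ^ r * ((-1) ^ r * U ^ r) := by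
    rw [neg_pow, mul_pow]
    ring
  rw [hX] at hP
  refine ⟨(-1) ^ r * U ^ r * p * T, ?_⟩
  linear_combination T * hP + T * B ^ r * S * hq + PowerSeries.C (∏ i, (a i : ℂ)) * B ^ r * S * hTV
    - T * q * S * hBUr

/-- Comparison of the coefficients of `t^{r - m}` after multiplication by `U(t)^{m - 1} e^t`, where
`U(t) = (e^t - 1) / t`: this isolates `c_{1,m}`. -/
theorem coeff_at_one_of_isPartialFractionDecomposition {r : ℕ} (hr : 1 ≤ r) {a : Fin r → ℕ}
    (ha : ∀ i, 0 < a i) {c : ℂ → ℕ → ℂ} (hc : IsPartialFractionDecomposition a c) {m : ℕ}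
    (hm : 1 ≤ m) (hmr : m ≤ r) :
    PowerSeries.coeff (r - m) (expSubOneDivX ^ (m - 1) * PowerSeries.exp ℂ *
        ∏ i, PowerSeries.rescale (a i : ℂ) (bernoulliPowerSeries ℂ)) =
      (∏ i, (a i : ℂ)) * ((-1) ^ (r - m) * c 1 m) := by
  obtain ⟨R, hR⟩ := exists_prod_rescale_bernoulliPowerSeries_eq hr ha hc
  have hBU := bernoulliPowerSeries_mul_expSubOneDivX
  have hexpand : expSubOneDivX ^ (m - 1) * PowerSeries.exp ℂ *
      ∏ i, PowerSeries.rescale (a i : ℂ) (bernoulliPowerSeries ℂ) =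
        PowerSeries.C (∏ i, (a i : ℂ)) * ∑ k ∈ Finset.Icc 1 r,
          PowerSeries.C ((-1) ^ (r - k) * c 1 k) * (PowerSeries.X ^ (r - k) *
            (bernoulliPowerSeries ℂ ^ k * expSubOneDivX ^ (m - 1) * PowerSeries.exp ℂ)) +
        PowerSeries.X ^ r * (R * expSubOneDivX ^ (m - 1) * PowerSeries.exp ℂ) := by
    have hsum : ∑ k ∈ Finset.Icc 1 r,
        PowerSeries.C ((-1) ^ (r - k) * c 1 k) * (PowerSeries.X ^ (r - k) *
          (bernoulliPowerSeries ℂ ^ k * expSubOneDivX ^ (m - 1) * PowerSeries.exp ℂ)) =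
        (∑ k ∈ Finset.Icc 1 r, PowerSeries.C ((-1) ^ (r - k) * c 1 k) *
          (PowerSeries.X ^ (r - k) * bernoulliPowerSeries ℂ ^ k)) *
            (expSubOneDivX ^ (m - 1) * PowerSeries.exp ℂ) := by
      rw [Finset.sum_mul]
      exact Finset.sum_congr rfl fun k _ => by simp only [mul_assoc]
    rw [hR, hsum]
    ring
  rw [hexpand, map_add, PowerSeries.coeff_C_mul, map_sum, PowerSeries.coeff_X_pow_mul',
    if_neg (by omega), add_zero]
  refine congrArg _ ?_
  rw [Finset.sum_eq_single_of_mem m (Finset.mem_Icc.2 ⟨hm, hmr⟩)]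
  · have hB : bernoulliPowerSeries ℂ ^ m * expSubOneDivX ^ (m - 1) =
        bernoulliPowerSeries ℂ ^ (0 + 1) := by
      obtain ⟨j, rfl⟩ : ∃ j, m = j + 1 := ⟨m - 1, by omega⟩
      rw [Nat.add_sub_cancel, pow_succ', mul_assoc, ← mul_pow, hBU]
      simp
    rw [PowerSeries.coeff_C_mul, PowerSeries.coeff_X_pow_mul', if_pos le_rfl, Nat.sub_self, hB,
      coeff_bernoulliPowerSeries_pow_mul_exp, if_pos rfl, mul_one]
  · intro k hk hkm
    obtain ⟨hk₁, hk₂⟩ := Finset.mem_Icc.1 hk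
    rw [PowerSeries.coeff_C_mul, PowerSeries.coeff_X_pow_mul']
    split_ifs with h
    · have hB : bernoulliPowerSeries ℂ ^ k * expSubOneDivX ^ (m - 1) =
          bernoulliPowerSeries ℂ ^ (k - m + 1) := by
        have hk₃ : bernoulliPowerSeries ℂ ^ k =
            bernoulliPowerSeries ℂ ^ (k - m + 1) * bernoulliPowerSeries ℂ ^ (m - 1) := by
          rw [← pow_add]
          congr 1
          omega
        rw [hk₃, mul_assoc, ← mul_pow, hBU, one_pow, mul_one]
      rw [hB, show r - m - (r - k) = k - m by omega, coeff_bernoulliPowerSeries_pow_mul_exp,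
        if_neg (by omega), mul_zero]
    · exact mul_zero _

theorem coeff_expSubOneDivX_pow_mul_exp_mul {r m : ℕ} (hm : 1 ≤ m) (hmr : m ≤ r)
    (T : PowerSeries ℂ) :
    PowerSeries.coeff (r - m) (expSubOneDivX ^ (m - 1) * PowerSeries.exp ℂ * T) =
      ∑ ℓ ∈ Finset.Icc m r, (m - 1).factorial * (Nat.stirlingSecond ℓ m : ℂ) /
        (ℓ - 1).factorial * PowerSeries.coeff (r - ℓ) T := by
  rw [PowerSeries.coeff_mul]
  refine Finset.sum_bij (fun p _ => p.1 + m) (fun p hp => ?_) (fun p hp p' hp' h => ?_)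
    (fun ℓ hℓ => ?_) (fun p hp => ?_)
  · rw [Finset.HasAntidiagonal.mem_antidiagonal] at hp
    exact Finset.mem_Icc.2 (by omega)
  · rw [Finset.HasAntidiagonal.mem_antidiagonal] at hp hp'
    ext <;> omega
  · obtain ⟨h₁, h₂⟩ := Finset.mem_Icc.1 hℓ
    exact ⟨(ℓ - m, r - ℓ), Finset.HasAntidiagonal.mem_antidiagonal.2 (by omega), by simp; omega⟩
  · rw [Finset.HasAntidiagonal.mem_antidiagonal] at hp
    rw [coeff_expSubOneDivX_pow_mul_exp, show p.1 + (m - 1) + 1 = p.1 + m by omega,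
      show m - 1 + 1 = m by omega, show p.1 + (m - 1) = p.1 + m - 1 by omega,
      show p.2 = r - (p.1 + m) by omega]

theorem proposition4p5 (r : ℕ) (hr : 1 ≤ r) (a : Fin r → ℕ) (ha : ∀ i, 0 < a i) :
    (∀ z : ℂ, ‖z‖ < 1 →
      HasSum (fun n : ℕ => (restrictedPartition a n : ℂ) * z ^ n)
        (1 / (partitionDenominator a).eval z)) ∧
    (∃ c : ℂ → ℕ → ℂ, IsPartialFractionDecomposition a c) ∧
    (partitionDenominator a).rootMultiplicity 1 = r ∧
    ∀ c : ℂ → ℕ → ℂ, IsPartialFractionDecomposition a c →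
      ∀ m : ℕ, 1 ≤ m → m ≤ r →
        c 1 m =
          ((m - 1).factorial : ℂ) / (∏ k, (a k : ℂ)) *
            ∑ ℓ ∈ Finset.Icc m r,
              (-1 : ℂ) ^ (r - m) * (Nat.stirlingSecond ℓ m : ℂ) / ((ℓ - 1).factorial : ℂ) *
                ∑ i ∈ Finset.piAntidiag (Finset.univ : Finset (Fin r)) (r - ℓ),
                  (∏ k, ((_root_.bernoulli (i k) : ℚ) : ℂ)) / (∏ k, ((i k).factorial : ℂ)) *
                    ∏ k, (a k : ℂ) ^ i k := by
  have hmult := rootMultiplicity_one_partitionDenominator ha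
  refine ⟨fun z hz => hasSum_restrictedPartition ha hz, ?_, hmult, fun c hc m hm hmr => ?_⟩
  · have hdeg : (partitionDenominator a).natDegree ≠ 0 := fun h => by
      rw [eq_C_of_natDegree_eq_zero h, rootMultiplicity_C] at hmult
      omega
    obtain ⟨c, hc⟩ := exists_sum_rootCofactor hdeg
    exact ⟨c, (isPartialFractionDecomposition_iff ha c).2 hc⟩
  · have h := coeff_at_one_of_isPartialFractionDecomposition hr ha hc hm hmr
    have hA : (∏ k, (a k : ℂ)) ≠ 0 :=
      Finset.prod_ne_zero_iff.2 fun i _ => Nat.cast_ne_zero.2 (ha i).ne'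
    have hsign : ((-1 : ℂ) ^ (r - m)) * (-1) ^ (r - m) = 1 := by
      rw [← mul_pow]
      simp
    rw [coeff_expSubOneDivX_pow_mul_exp_mul hm hmr] at h
    simp only [coeff_prod_rescale_bernoulliPowerSeries] at h
    have hsum : c 1 m = (-1) ^ (r - m) / (∏ k, (a k : ℂ)) *
        ((∏ k, (a k : ℂ)) * ((-1) ^ (r - m) * c 1 m)) := by
      field_simp
      linear_combination (-c 1 m) * hsign
    rw [hsum, ← h, Finset.mul_sum, Finset.mul_sum]
    refine Finset.sum_congr rfl fun ℓ _ => ?_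
    ring
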